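/- All manifolds are smooth, Hausdorff, second countable and without boundary. Let $(M,g)$ be a connected Riemannian manifold that is a Riemannian cover of a compact Riemannian manifold $(N,h)$, i.e. there is a surjective smooth covering map $f:M\to N$ with $f^*h=g$. For $p\in M$ let $$h_{vol}^+(M,g):=\limsup_{r\to\infty}\frac{\ln \mathrm{Vol}_g(B_p(r))}{r}\in[-\infty,\infty]$$ be the upper volume entropy, where $B_p(r)$ is the open ball of radius $r$ around $p$ for the Riemannian distance $d_g$. When the limit exists, it is the volume entropy $h_{vol}(M,g)$, so that $h_{vol}^+(M,g)=h_{vol}(M,g)$. A $C$-almost-isometry between metric spaces $(X,d_X)$ and $(Y,d_Y)$, where $C\ge 0$, is a map $\phi:X\to Y$ such that $d_X(x_1,x_2)-C\le d_Y(\phi x_1,\phi x_2)\le d_X(x_1,x_2)+C$ for all $x_1,x_2\in X$ and such that for each $y\in Y$ there is an $x\in X$ with $d_Y(\phi x,y)\le C$. Two metric spaces are almost-isometric if there is a $C$-almost-isometry from the first to the second for some $C\ge 0$. If $h_{vol}^+(M,g)>0$ for some basepoint $p\in M$ (in particular, if the volume entropy $h_{vol}(M,g)$ is defined and positive), then for every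 real $\lambda>0$ with $\lambda\neq 1$, the Riemannian manifolds $(M,g)$ and $(M,\lambda g)$, with their Riemannian distances, are not almost-isometric. -/

import Mathlib

open Bundle Manifold MeasureTheory Filter Set
open scoped ContDiff ENNReal Topology

noncomputable section

/-! ### Quasi-isometries and almost-isometries -/

/-- `φ : X → Y` is a `(K, C)`-quasi-isometry for the distance functions `dX` and `dY`: it distorts
distances by at most the factor `K` and the additive error `C`, and it is `C`-coarsely onto. -/
structure IsQuasiIsometry {X Y : Type*} (dX : X → X → ℝ) (dY : Y → Y → ℝ) (K C : ℝ)
    (φ : X → Y) : Prop where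
  one_le : 1 ≤ K
  nonneg : 0 ≤ C
  lower : ∀ x₁ x₂, (1 / K) * dX x₁ x₂ - C ≤ dY (φ x₁) (φ x₂)
  upper : ∀ x₁ x₂, dY (φ x₁) (φ x₂) ≤ K * dX x₁ x₂ + C
  coarselyOnto : ∀ y, ∃ x, dY (φ x) y ≤ C

/-- An almost-isometry is a quasi-isometry with multiplicative constant one. -/
def IsAlmostIsometry {X Y : Type*} (dX : X → X → ℝ) (dY : Y → Y → ℝ) (C : ℝ)
    (φ : X → Y) : Prop :=
  IsQuasiIsometry dX dY 1 C φ

/-- Two spaces are almost-isometric if there is an almost-isometry from one to the other. -/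
def AlmostIsometric {X Y : Type*} (dX : X → X → ℝ) (dY : Y → Y → ℝ) : Prop :=
  ∃ (C : ℝ) (φ : X → Y), IsAlmostIsometry dX dY C φ

/-! ### Riemannian metrics: distance, scaling, volume, entropy, coverings -/

/-- Smooth Riemannian metrics on an `n`-dimensional smooth manifold without boundary. -/
abbrev SmoothRiemannianMetric (n : ℕ) (M : Type*) [TopologicalSpace M]
    [ChartedSpace (EuclideanSpace ℝ (Fin n)) M] [IsManifold (𝓡 n) ∞ M] :=
  ContMDiffRiemannianMetric (𝓡 n) ∞ (EuclideanSpace ℝ (Fin n))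
    (fun x : M => TangentSpace (𝓡 n) x)

namespace SmoothRiemannianMetric

variable {n : ℕ} {M : Type*} [TopologicalSpace M] [ChartedSpace (EuclideanSpace ℝ (Fin n)) M]
  [IsManifold (𝓡 n) ∞ M]

/-- The extended distance of `g`: the infimum of the `g`-lengths of `C^1` paths. -/
def edist (g : SmoothRiemannianMetric n M) (x y : M) : ℝ≥0∞ :=
  letI : RiemannianBundle (fun x : M => TangentSpace (𝓡 n) x) := ⟨g.toRiemannianMetric⟩
  riemannianEDist (𝓡 n) x y

/-- The Riemannian distance of `g` (`edist` is finite when `M` is connected). -/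
def dist (g : SmoothRiemannianMetric n M) (x y : M) : ℝ :=
  (g.edist x y).toReal

/-- The open `g`-ball of radius `r` centred at `p`. -/
def ball (g : SmoothRiemannianMetric n M) (p : M) (r : ℝ) : Set M :=
  {x | g.edist p x < ENNReal.ofReal r}

/-- The metric `c g`, for a constant `c > 0`. -/
def scale (g : SmoothRiemannianMetric n M) (c : ℝ) (hc : 0 < c) :
    SmoothRiemannianMetric n M where
  inner x := c • g.inner x
  symm x v w := by
    simpa using congrArg (c * ·) (g.symm x v w)
  pos x v hv := by
    simpa using mul_pos hc (g.pos x v hv)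
  isVonNBounded x := by
    refine ((g.isVonNBounded x).image
      ((√c)⁻¹ • ContinuousLinearMap.id ℝ (TangentSpace (𝓡 n) x))).subset ?_
    intro v hv
    have hs : √c ≠ 0 := (Real.sqrt_pos.2 hc).ne'
    refine ⟨√c • v, ?_, ?_⟩
    · have h : c * g.inner x v v < 1 := by simpa using hv
      simpa [← mul_assoc, Real.mul_self_sqrt hc.le] using h
    · simp [smul_smul, mul_inv_cancel₀ hs]
  contMDiff := by
    intro x
    have h := g.contMDiff x
    rw [contMDiffAt_section] at h ⊢
    have hk : ContMDiffAt (𝓡 n) 𝓘(ℝ, ℝ) ∞ (fun _ : M => c) x := contMDiffAt_const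
    refine (hk.smul h).congr_of_eventuallyEq (Eventually.of_forall ?_)
    intro y
    ext v w
    simp [hom_trivializationAt_apply, ContinuousLinearMap.inCoordinates]

/-- The matrix `g_ij = g(∂_i, ∂_j)` of `g` in the chart `e`, at the point `y` of its target. -/
def gram (g : SmoothRiemannianMetric n M)
    (e : OpenPartialHomeomorph M (EuclideanSpace ℝ (Fin n))) (y : EuclideanSpace ℝ (Fin n)) :
    Matrix (Fin n) (Fin n) ℝ :=
  Matrix.of fun i j =>
    g.inner (e.symm y)
      (mfderiv (𝓡 n) (𝓡 n) e.symm y (EuclideanSpace.single i (1 : ℝ)))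
      (mfderiv (𝓡 n) (𝓡 n) e.symm y (EuclideanSpace.single j (1 : ℝ)))

/-- The volume of `g` in the domain of the chart `e`, as a measure on `M`:
Lebesgue measure with density `√(det g_ij)` on the target of `e`, transported to `M`. -/
def chartVolume [MeasurableSpace M] (g : SmoothRiemannianMetric n M)
    (e : OpenPartialHomeomorph M (EuclideanSpace ℝ (Fin n))) : Measure M :=
  ((volume.restrict e.target).withDensity
    (fun y => ENNReal.ofReal √((g.gram e y).det))).map e.symm

/-- The Riemannian volume measure of `g`: the least measure on `M` which is bounded below by the
volume of `g` in each smooth chart. As these chart volumes agree on overlaps of charts, its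
restriction to the domain of any smooth chart is the volume in this chart. -/
def vol [MeasurableSpace M] (g : SmoothRiemannianMetric n M) : Measure M :=
  ⨆ e ∈ IsManifold.maximalAtlas (𝓡 n) ∞ M, g.chartVolume e

/-- The upper volume entropy: the upper limit, as `r → ∞`, of `log (Vol (B_p(r))) / r`. Whenever
the limit exists, it is the volume entropy. -/
def upperVolumeEntropy [MeasurableSpace M] (g : SmoothRiemannianMetric n M) (p : M) : EReal :=
  limsup (fun r : ℝ => ENNReal.log (g.vol (g.ball p r)) / (r : EReal)) atTop

end SmoothRiemannianMetric

/-- `f : M → N` is a Riemannian covering from `(M, g)` onto `(N, h)`: a surjective smooth covering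
map with `f^* h = g`. -/
structure IsRiemannianCovering {n : ℕ}
    {M : Type*} [TopologicalSpace M] [ChartedSpace (EuclideanSpace ℝ (Fin n)) M]
    [IsManifold (𝓡 n) ∞ M]
    {N : Type*} [TopologicalSpace N] [ChartedSpace (EuclideanSpace ℝ (Fin n)) N]
    [IsManifold (𝓡 n) ∞ N]
    (g : SmoothRiemannianMetric n M) (h : SmoothRiemannianMetric n N) (f : M → N) : Prop where
  isCoveringMap : IsCoveringMap f
  surjective : Function.Surjective f
  contMDiff : ContMDiff (𝓡 n) (𝓡 n) ∞ f
  pullback : ∀ (x : M) (v w : TangentSpace (𝓡 n) x),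
    h.inner (f x) (mfderiv (𝓡 n) (𝓡 n) f x v) (mfderiv (𝓡 n) (𝓡 n) f x w) = g.inner x v w

end

/-! ### Exponential growth of coverings by balls -/

/-! Multiplying the metric by λ multiplies the distance by s = √λ, so an almost-isometry is a
self-map φ of M that carries d to s·d up to a bounded error. The invariant that detects this is
exponential growth of covering numbers: a is a growth rate if, at some fixed scale, R-balls are
covered by O(exp(aR)) balls. Since the scale and the constant are free, additive errors are
harmless, and pushing coverings forward or pulling them back along φ turns a rate a into a·s and
into a/s (`HasCoveringGrowth.mul_of_almostIsometry`, `HasCoveringGrowth.div_of_almostIsometry`). As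
s ≠ 1, iterating one of these makes the rates tend to 0, once a single finite rate exists.

Compactness of N supplies the rest (`IsRiemannianCovering.exists_uniform_bounds`). Below a Lebesgue
number, balls of M sit in single sheets over N, so at some scale ρ ball volumes are uniformly
bounded and 2ρ-balls are covered by boundedly many ρ-balls. In a length space the latter gives a
finite rate. It also allows any covering to be refined to ρ-balls, so each rate bounds the volume
entropy from above (`SmoothRiemannianMetric.upperVolumeEntropy_le_of_hasCoveringGrowth`). Positive
entropy therefore keeps the rates away from 0, a contradiction. Only upper bounds on volumes are
needed. -/

/-- The set `A` is covered by at most `m` open balls of radius `ε` for `d`. -/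
def CoveredByBalls {X : Type*} (d : X → X → ℝ) (A : Set X) (ε m : ℝ) : Prop :=
  ∃ s : Finset X, (s.card : ℝ) ≤ m ∧ ∀ x ∈ A, ∃ y ∈ s, d y x < ε

/-- At some scale `L`, the number of `L`-balls needed to cover the `R`-ball around `p`
is `O(exp (a R))`. -/
def HasCoveringGrowth {X : Type*} (d : X → X → ℝ) (p : X) (a : ℝ) : Prop :=
  ∃ L K : ℝ, 0 < L ∧ 0 < K ∧
    ∀ R : ℝ, 0 ≤ R → CoveredByBalls d {x | d p x < R} L (K * Real.exp (a * R))

namespace CoveredByBalls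

variable {X : Type*} {d : X → X → ℝ}

theorem mono {A B : Set X} {ε m m' : ℝ} (h : CoveredByBalls d B ε m) (hA : A ⊆ B) (hm : m ≤ m') :
    CoveredByBalls d A ε m' := by
  obtain ⟨s, hs, hB⟩ := h
  exact ⟨s, hs.trans hm, fun x hx => hB x (hA hx)⟩

/-- Refining a covering: if the members of a covering by balls have coverings by smaller balls, so
does a set which is captured by enlarged balls. -/
theorem refine {A B : Set X} {ε η δ m k : ℝ} (hk : 0 ≤ k) (h : CoveredByBalls d B ε m)
    (hB : ∀ y, (∃ x ∈ B, d y x < ε) → CoveredByBalls d {x | d y x < η} δ k)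
    (hA : ∀ x ∈ A, ∃ z ∈ B, ∀ y, d y z < ε → d y x < η) :
    CoveredByBalls d A δ (m * k) := by
  classical
  obtain ⟨s, hs, hsB⟩ := h
  have hB' : ∀ y, ∃ t : Finset X, (t.card : ℝ) ≤ k ∧
      ((∃ x ∈ B, d y x < ε) → ∀ x, d y x < η → ∃ z ∈ t, d z x < δ) := by
    intro y
    by_cases hy : ∃ x ∈ B, d y x < ε
    · obtain ⟨t, ht, h⟩ := hB y hy
      exact ⟨t, ht, fun _ x hx => h x hx⟩
    -- A ball that misses `B` is never used, so the empty family will do.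
    · exact ⟨∅, by simpa using hk, fun h => (hy h).elim⟩
  choose t ht htB using hB'
  refine ⟨s.biUnion t, ?_, ?_⟩
  · calc ((s.biUnion t).card : ℝ) ≤ ∑ y ∈ s, ((t y).card : ℝ) := by
          exact_mod_cast Finset.card_biUnion_le
      _ ≤ ∑ _y ∈ s, k := Finset.sum_le_sum fun y _ => ht y
      _ = s.card * k := by simp
      _ ≤ m * k := by gcongr
  · intro x hx
    obtain ⟨z, hz, hzx⟩ := hA x hx
    obtain ⟨y, hy, hyz⟩ := hsB z hz
    obtain ⟨w, hw, hwx⟩ := htB y ⟨z, hz, hyz⟩ x (hzx y hyz)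
    exact ⟨w, Finset.mem_biUnion.2 ⟨y, hy, hw⟩, hwx⟩

end CoveredByBalls

/-! ### Covering numbers in length spaces -/

section LengthSpace

variable {X : Type*} {d : X → X → ℝ}

/-- In a space with approximate intermediate points, a uniform bound on the covering of balls
of radius `2 ρ` by balls of radius `ρ` implies an exponential bound for all balls. -/
theorem coveredByBalls_of_doubling (htri : ∀ x y z, d x z ≤ d x y + d y z)
    (hlen : ∀ x y r s, 0 < r → 0 < s → d x y < r + s → ∃ z, d x z < r ∧ d z y < s)
    {ρ K : ℝ} (hρ : 0 < ρ) (hK : 1 ≤ K)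
    (hcov : ∀ x, CoveredByBalls d {y | d x y < 2 * ρ} ρ K) (x : X) (k : ℕ) :
    CoveredByBalls d {y | d x y < (k + 1) * ρ} ρ (K ^ k) := by
  induction k with
  | zero => exact ⟨{x}, by simp, fun y hy => ⟨x, by simp, by simpa using hy⟩⟩
  | succ k ih =>
    rw [pow_succ]
    refine CoveredByBalls.refine (by linarith) ih (fun y _ => hcov y) ?_
    intro y hy
    -- Stop at distance less than ρ before y: a ρ-ball that contains z has y in its 2ρ-enlargement,
    -- and the doubling bound costs one more factor K.
    obtain ⟨z, hz, hzy⟩ := hlen x y ((k + 1) * ρ) ρ (by positivity) hρ (by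
      have : d x y < ((k + 1 : ℕ) + 1) * ρ := hy
      push_cast at this
      linarith)
    exact ⟨z, hz, fun w hw => (htri w z y).trans_lt (by linarith)⟩

theorem coveredByBalls_exp_of_doubling (htri : ∀ x y z, d x z ≤ d x y + d y z)
    (hlen : ∀ x y r s, 0 < r → 0 < s → d x y < r + s → ∃ z, d x z < r ∧ d z y < s)
    {ρ K : ℝ} (hρ : 0 < ρ) (hK : 1 ≤ K)
    (hcov : ∀ x, CoveredByBalls d {y | d x y < 2 * ρ} ρ K) (x : X) {R : ℝ} (hR : 0 ≤ R) :
    CoveredByBalls d {y | d x y < R} ρ (Real.exp (Real.log K / ρ * R)) := by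
  have h := coveredByBalls_of_doubling htri hlen hρ hK hcov x ⌊R / ρ⌋₊
  refine h.mono ?_ ?_
  · intro y (hy : d x y < R)
    have := Nat.lt_floor_add_one (R / ρ)
    rw [div_lt_iff₀ hρ] at this
    exact hy.trans this
  · have h1 : (⌊R / ρ⌋₊ : ℝ) ≤ R / ρ := Nat.floor_le (by positivity)
    have hK0 : 0 < K := by linarith
    rw [← Real.exp_log (pow_pos hK0 _), Real.log_pow]
    refine Real.exp_le_exp.2 ?_
    calc (⌊R / ρ⌋₊ : ℝ) * Real.log K ≤ R / ρ * Real.log K := by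
          gcongr
          exact Real.log_nonneg hK
      _ = Real.log K / ρ * R := by ring

end LengthSpace

/-! ### Growth rates under almost-isometries onto a rescaled space -/

section AlmostIsometry

variable {X : Type*} {d : X → X → ℝ} {s C : ℝ} {φ : X → X}

/-- Coarse surjectivity lets the image under φ of a covering of a ball of radius about sR cover the
R-ball; additive errors go into the scale and the constant. -/
theorem HasCoveringGrowth.mul_of_almostIsometry (hsymm : ∀ x y, d x y = d y x)
    (htri : ∀ x y z, d x z ≤ d x y + d y z) (hnn : ∀ x y, 0 ≤ d x y)
    (hs : 0 < s) (hφ : IsAlmostIsometry d (fun x y => s * d x y) C φ) {p : X} {a : ℝ}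
    (h : HasCoveringGrowth d p a) : HasCoveringGrowth d p (a * s) := by
  classical
  obtain ⟨L, K, hL, hK, h⟩ := h
  have hC := hφ.nonneg
  set C' := s * d (φ p) p + 2 * C with hC'
  have hC'0 : 0 ≤ C' := by have := hnn (φ p) p; positivity
  refine ⟨(L + 2 * C) / s, K * Real.exp (a * C'), by positivity, by positivity, fun R hR => ?_⟩
  obtain ⟨t, ht, htB⟩ := h (s * R + C') (by positivity)
  refine ⟨t.image φ, ?_, ?_⟩
  · calc ((t.image φ).card : ℝ) ≤ t.card := by exact_mod_cast Finset.card_image_le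
      _ ≤ _ := ht
      _ = _ := by rw [mul_assoc, ← Real.exp_add]; ring_nf
  · intro y (hy : d p y < R)
    obtain ⟨x, hx⟩ := hφ.coarselyOnto y
    have h1 := hφ.lower p x
    have h2 := htri (φ p) p (φ x)
    have h3 := htri p y (φ x)
    rw [hsymm y] at h3
    simp only [div_one, one_mul] at h1 hx
    obtain ⟨z, hz, hzx⟩ := htB x (by
      change d p x < _
      nlinarith)
    refine ⟨φ z, Finset.mem_image_of_mem _ hz, ?_⟩
    have h4 := hφ.upper z x
    have h5 := htri (φ z) (φ x) y
    simp only [one_mul] at h4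
    rw [lt_div_iff₀ hs]
    nlinarith

/-- The R-ball is mapped into a ball of radius about R/s, and a covering of the latter is pulled
back. -/
theorem HasCoveringGrowth.div_of_almostIsometry (hsymm : ∀ x y, d x y = d y x)
    (htri : ∀ x y z, d x z ≤ d x y + d y z) (hnn : ∀ x y, 0 ≤ d x y)
    (hs : 0 < s) (hφ : IsAlmostIsometry d (fun x y => s * d x y) C φ) {p : X} {a : ℝ}
    (h : HasCoveringGrowth d p a) : HasCoveringGrowth d p (a / s) := by
  classical
  obtain ⟨L, K, hL, hK, h⟩ := h
  have hC := hφ.nonneg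
  set C' := d p (φ p) + C / s with hC'
  have hC'0 : 0 ≤ C' := by have := hnn p (φ p); positivity
  refine ⟨2 * s * L + C, K * Real.exp (a * C'), by positivity, by positivity, fun R hR => ?_⟩
  obtain ⟨t, ht, htB⟩ := h (R / s + C') (by positivity)
  -- A centre y need not lie in the image of φ; it is replaced by a point whose image is L-close to
  -- y, which doubles L in the new scale.
  have hch : ∀ y, ∃ x, (∃ x', d y (φ x') < L) → d y (φ x) < L := fun y => by
    by_cases hy : ∃ x', d y (φ x') < L
    · obtain ⟨x, hx⟩ := hy
      exact ⟨x, fun _ => hx⟩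
    · exact ⟨y, fun h => (hy h).elim⟩
  choose ψ hψ using hch
  refine ⟨t.image ψ, ?_, ?_⟩
  · calc ((t.image ψ).card : ℝ) ≤ t.card := by exact_mod_cast Finset.card_image_le
      _ ≤ _ := ht
      _ = _ := by rw [mul_assoc, ← Real.exp_add]; ring_nf
  · intro x (hx : d p x < R)
    have h1 := hφ.upper p x
    simp only [one_mul] at h1
    have h2 : d (φ p) (φ x) < R / s + C / s := by
      rw [← add_div, lt_div_iff₀ hs]
      linarith
    have h3 := htri p (φ p) (φ x)
    obtain ⟨y, hy, hyx⟩ := htB (φ x) (by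
      change d p (φ x) < _
      linarith)
    refine ⟨ψ y, Finset.mem_image_of_mem _ hy, ?_⟩
    have h4 := hψ y ⟨x, hyx⟩
    have h5 := hφ.lower (ψ y) x
    simp only [div_one, one_mul] at h5
    have h6 := htri (φ (ψ y)) y (φ x)
    rw [hsymm (φ (ψ y)) y] at h6
    nlinarith

/-- If the covering growth rates are bounded below by a positive number, then the space is
not almost-isometric to a rescaling of itself. -/
theorem not_isAlmostIsometry_of_hasCoveringGrowth (hsymm : ∀ x y, d x y = d y x)
    (htri : ∀ x y z, d x z ≤ d x y + d y z) (hnn : ∀ x y, 0 ≤ d x y)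
    (hs : 0 < s) (hs1 : s ≠ 1) {p : X} {a b : ℝ} (h : HasCoveringGrowth d p a)
    (hb : 0 < b) (hlow : ∀ a', HasCoveringGrowth d p a' → b ≤ a') :
    ¬ IsAlmostIsometry d (fun x y => s * d x y) C φ := by
  intro hφ
  -- Whichever of s and s⁻¹ is less than 1 serves as the contraction factor q; then a·q^k eventually
  -- drops below b.
  have key : ∀ q : ℝ, 0 < q → q < 1 →
      (∀ a', HasCoveringGrowth d p a' → HasCoveringGrowth d p (a' * q)) → False := by
    intro q hq hq1 hstep
    have hall : ∀ k : ℕ, HasCoveringGrowth d p (a * q ^ k) := by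
      intro k
      induction k with
      | zero => simpa using h
      | succ k ih => simpa [pow_succ, mul_assoc] using hstep _ ih
    have ha : 0 < a := hb.trans_le (hlow a h)
    obtain ⟨k, hk⟩ := exists_pow_lt_of_lt_one (div_pos hb ha) hq1
    have := hlow _ (hall k)
    rw [lt_div_iff₀ ha] at hk
    linarith
  rcases lt_or_gt_of_ne hs1 with h1 | h1
  · exact key s hs h1 fun a' h' => h'.mul_of_almostIsometry hsymm htri hnn hs hφ
  · exact key s⁻¹ (inv_pos.2 hs) (inv_lt_one_of_one_lt₀ h1) fun a' h' => by
      simpa [div_eq_mul_inv] using h'.div_of_almostIsometry hsymm htri hnn hs hφ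

end AlmostIsometry

/-! ### Local isometries and coverings -/

section LocalIsometry

variable {n : ℕ}
  {M : Type*} [TopologicalSpace M] [ChartedSpace (EuclideanSpace ℝ (Fin n)) M]
  [IsManifold (𝓡 n) ∞ M]
  {N : Type*} [TopologicalSpace N] [ChartedSpace (EuclideanSpace ℝ (Fin n)) N]

/-- A continuous curve whose image under a map with injective differential is `C^1` is itself
`C^1`, in equal dimensions. -/
theorem contMDiffWithinAt_of_comp_of_injective_mfderiv {f : M → N} {Γ : ℝ → M} {s : Set ℝ} {t : ℝ}
    (hf : ContMDiffAt (𝓡 n) (𝓡 n) 1 f (Γ t))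
    (hinj : Function.Injective (mfderiv (𝓡 n) (𝓡 n) f (Γ t)))
    (hΓ : ContinuousWithinAt Γ s t)
    (h : ContMDiffWithinAt 𝓘(ℝ, ℝ) (𝓡 n) 1 (f ∘ Γ) s t) :
    ContMDiffWithinAt 𝓘(ℝ, ℝ) (𝓡 n) 1 Γ s t := by
  set x := Γ t with hx
  set F : EuclideanSpace ℝ (Fin n) → EuclideanSpace ℝ (Fin n) :=
    writtenInExtChartAt (𝓡 n) (𝓡 n) x f with hF
  set a := extChartAt (𝓡 n) x x with ha
  have hFa : ContDiffAt ℝ 1 F a := by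
    have := (contMDiffAt_iff.1 hf).2
    simpa [hF, ha, writtenInExtChartAt, contDiffWithinAt_univ] using this
  have hder : mfderiv (𝓡 n) (𝓡 n) f x = fderiv ℝ F a := by
    rw [(hf.mdifferentiableAt one_ne_zero).mfderiv]
    rw [ModelWithCorners.range_eq_univ, fderivWithin_univ]
  have hinj' : Function.Injective (fderiv ℝ F a) := by
    rw [← hder]; exact hinj
  -- In equal finite dimensions an injective differential is invertible, so the inverse function
  -- theorem gives a local C^1 inverse G of F.
  let L : EuclideanSpace ℝ (Fin n) ≃L[ℝ] EuclideanSpace ℝ (Fin n) :=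
    (LinearEquiv.ofInjectiveEndo (fderiv ℝ F a).toLinearMap hinj').toContinuousLinearEquiv
  have hL : HasFDerivAt F (L : _ →L[ℝ] _) a := by
    have : (L : EuclideanSpace ℝ (Fin n) →L[ℝ] EuclideanSpace ℝ (Fin n)) = fderiv ℝ F a := by
      ext1 v; rfl
    rw [this]
    exact (hFa.differentiableAt one_ne_zero).hasFDerivAt
  have hS := hFa.hasStrictFDerivAt' hL one_ne_zero
  set G := hFa.localInverse hL one_ne_zero
  have hG : ContDiffAt ℝ 1 G (F a) := hFa.to_localInverse hL one_ne_zero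
  have hGF : ∀ᶠ y in 𝓝 a, G (F y) = y := hS.eventually_left_inverse
  have hFa' : F a = extChartAt (𝓡 n) (f x) (f x) := by
    simp [hF, ha, writtenInExtChartAt]
  have hGFa : G (F a) = a := hGF.self_of_nhds
  have h1 : ContMDiffWithinAt 𝓘(ℝ, ℝ) 𝓘(ℝ, EuclideanSpace ℝ (Fin n)) 1
      (extChartAt (𝓡 n) (f x) ∘ (f ∘ Γ)) s t :=
    (contMDiffAt_extChartAt (x := f x)).comp_contMDiffWithinAt (x := t) (f := f ∘ Γ) h
  have h2 : ContMDiffWithinAt 𝓘(ℝ, ℝ) 𝓘(ℝ, EuclideanSpace ℝ (Fin n)) 1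
      (G ∘ (extChartAt (𝓡 n) (f x) ∘ (f ∘ Γ))) s t := by
    refine ContMDiffAt.comp_contMDiffWithinAt (x := t) ?_ h1
    have : (extChartAt (𝓡 n) (f x) ∘ (f ∘ Γ)) t = F a := by simp [hFa', hx]
    rw [this]
    exact hG.contMDiffAt
  have h3 : ContMDiffWithinAt 𝓘(ℝ, ℝ) (𝓡 n) 1
      ((extChartAt (𝓡 n) x).symm ∘ (G ∘ (extChartAt (𝓡 n) (f x) ∘ (f ∘ Γ)))) s t := by
    refine ContMDiffAt.comp_contMDiffWithinAt (x := t) ?_ h2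
    have : (G ∘ (extChartAt (𝓡 n) (f x) ∘ (f ∘ Γ))) t = a := by
      have : (extChartAt (𝓡 n) (f x) ∘ (f ∘ Γ)) t = F a := by simp [hFa', hx]
      rw [Function.comp_apply, this, hGFa]
    rw [this]
    have := contMDiffOn_extChartAt_symm (I := 𝓡 n) (n := 1) x
    exact this.contMDiffAt (extChartAt_target_mem_nhds x)
  -- Continuity of Γ keeps it where G inverts F, so there it equals the C^1 curve built from f ∘ Γ.
  refine h3.congr_of_eventuallyEq ?_ ?_
  · have hsrc : ∀ᶠ τ in 𝓝[s] t, Γ τ ∈ (extChartAt (𝓡 n) x).source :=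
      hΓ (extChartAt_source_mem_nhds x)
    have hloc : ∀ᶠ τ in 𝓝[s] t, G (F (extChartAt (𝓡 n) x (Γ τ))) = extChartAt (𝓡 n) x (Γ τ) :=
      ((continuousAt_extChartAt (I := 𝓡 n) x).tendsto.comp hΓ).eventually hGF
    filter_upwards [hsrc, hloc] with τ h1 h2
    have h3 : F (extChartAt (𝓡 n) x (Γ τ)) = extChartAt (𝓡 n) (f x) (f (Γ τ)) := by
      simp only [hF, writtenInExtChartAt, Function.comp_apply]
      rw [(extChartAt (𝓡 n) x).left_inv h1]
    rw [h3] at h2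
    simp only [Function.comp_apply]
    rw [h2, (extChartAt (𝓡 n) x).left_inv h1]
  · have : (extChartAt (𝓡 n) (f x) ∘ (f ∘ Γ)) t = F a := by simp [hFa', hx]
    rw [Function.comp_apply, Function.comp_apply, this, hGFa]
    simp [ha, hx]

end LocalIsometry

section LocalIsometryLength

variable {n : ℕ}
  {M : Type*} [TopologicalSpace M] [ChartedSpace (EuclideanSpace ℝ (Fin n)) M]
  {N : Type*} [TopologicalSpace N] [ChartedSpace (EuclideanSpace ℝ (Fin n)) N]
variable [RiemannianBundle (fun x : M => TangentSpace (𝓡 n) x)]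
  [RiemannianBundle (fun x : N => TangentSpace (𝓡 n) x)]

/-- A local isometry preserves the length of curves. -/
theorem pathELength_comp_of_norm_mfderiv {f : M → N} (hf : ContMDiff (𝓡 n) (𝓡 n) 1 f)
    (hiso : ∀ (x : M) (v : TangentSpace (𝓡 n) x), ‖mfderiv (𝓡 n) (𝓡 n) f x v‖ = ‖v‖)
    {γ : ℝ → M} {a b : ℝ} (hγ : ContMDiffOn 𝓘(ℝ, ℝ) (𝓡 n) 1 γ (Icc a b)) :
    pathELength (𝓡 n) (f ∘ γ) a b = pathELength (𝓡 n) γ a b := by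
  simp only [pathELength_eq_lintegral_mfderiv_Ioo]
  refine setLIntegral_congr_fun measurableSet_Ioo fun t ht => ?_
  have hd : MDifferentiableAt 𝓘(ℝ, ℝ) (𝓡 n) γ t :=
    ((hγ t (Ioo_subset_Icc_self ht)).contMDiffAt (Icc_mem_nhds ht.1 ht.2)).mdifferentiableAt
      one_ne_zero
  have h1 := mfderiv_comp t (hf.mdifferentiable one_ne_zero (γ t)) hd
  have h2 : mfderiv 𝓘(ℝ, ℝ) (𝓡 n) (f ∘ γ) t 1 =
      mfderiv (𝓡 n) (𝓡 n) f (γ t) (mfderiv 𝓘(ℝ, ℝ) (𝓡 n) γ t 1) := congr($h1 1)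
  change ‖mfderiv 𝓘(ℝ, ℝ) (𝓡 n) (f ∘ γ) t 1‖ₑ = _
  rw [h2, ← ofReal_norm, ← ofReal_norm]
  congr 1
  exact hiso _ _

theorem injective_mfderiv_of_norm_mfderiv {f : M → N}
    (hiso : ∀ (x : M) (v : TangentSpace (𝓡 n) x), ‖mfderiv (𝓡 n) (𝓡 n) f x v‖ = ‖v‖) (x : M) :
    Function.Injective (mfderiv (𝓡 n) (𝓡 n) f x) := by
  rw [injective_iff_map_eq_zero]
  intro v hv
  have := hiso x v
  rw [hv, norm_zero] at this
  exact norm_eq_zero.1 this.symm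

variable {ι : Type*} [TopologicalSpace ι]

/-- A ball whose image is contained in an evenly covered ball is contained in one sheet. -/
theorem mem_sheet_of_riemannianEDist_lt [DiscreteTopology ι] {f : M → N} (hf : ContMDiff (𝓡 n) (𝓡 n) 1 f)
    (hiso : ∀ (x : M) (v : TangentSpace (𝓡 n) x), ‖mfderiv (𝓡 n) (𝓡 n) f x v‖ = ‖v‖)
    (e : Trivialization ι f) {x y : M} {r : ℝ≥0∞}
    (hr : {q | riemannianEDist (𝓡 n) (f x) q < r} ⊆ e.baseSet)
    (hxy : riemannianEDist (𝓡 n) x y < r) :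
    riemannianEDist (𝓡 n) (f x) (f y) < r ∧ (e y).2 = (e x).2 := by
  obtain ⟨γ, h0, h1, hγ, hlen⟩ := exists_lt_of_riemannianEDist_lt hxy
  have hball : ∀ t ∈ Icc (0 : ℝ) 1, riemannianEDist (𝓡 n) (f x) (f (γ t)) < r := by
    intro t ht
    have hγt : ContMDiffOn 𝓘(ℝ, ℝ) (𝓡 n) 1 γ (Icc 0 t) := hγ.mono (Icc_subset_Icc le_rfl ht.2)
    calc riemannianEDist (𝓡 n) (f x) (f (γ t)) ≤ pathELength (𝓡 n) (f ∘ γ) 0 t :=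
          riemannianEDist_le_pathELength (hf.comp_contMDiffOn hγt) (by simp [h0]) rfl ht.1
      _ = pathELength (𝓡 n) γ 0 t := pathELength_comp_of_norm_mfderiv hf hiso hγt
      _ ≤ pathELength (𝓡 n) γ 0 1 := pathELength_mono le_rfl ht.2
      _ < r := hlen
  have hsrc : MapsTo γ (Icc 0 1) e.source := fun t ht => e.mem_source.2 (hr (hball t ht))
  -- The sheet index is continuous along γ with values in a discrete space, hence constant.
  have hcont : ContinuousOn (fun t => (e (γ t)).2) (Icc (0 : ℝ) 1) :=
    continuous_snd.comp_continuousOn (e.continuousOn_toFun.comp hγ.continuousOn hsrc)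
  have hconst := isPreconnected_Icc.constant hcont (right_mem_Icc.2 zero_le_one)
    (left_mem_Icc.2 zero_le_one)
  simp only [h0, h1] at hconst
  exact ⟨h1 ▸ hball 1 (right_mem_Icc.2 zero_le_one), hconst⟩

/-- Short curves lift to the sheets of a Riemannian covering. -/
theorem riemannianEDist_lt_of_mem_sheet [IsManifold (𝓡 n) ∞ M] {f : M → N} (hf : ContMDiff (𝓡 n) (𝓡 n) 1 f)
    (hiso : ∀ (x : M) (v : TangentSpace (𝓡 n) x), ‖mfderiv (𝓡 n) (𝓡 n) f x v‖ = ‖v‖)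
    (e : Trivialization ι f) {x y : M} {r : ℝ≥0∞}
    (hr : {q | riemannianEDist (𝓡 n) (f x) q < r} ⊆ e.baseSet)
    (hxy : riemannianEDist (𝓡 n) (f x) (f y) < r) (hsheet : (e y).2 = (e x).2) :
    riemannianEDist (𝓡 n) x y < r := by
  obtain ⟨γ, h0, h1, hγ, hlen⟩ := exists_lt_of_riemannianEDist_lt hxy
  have hball : ∀ t ∈ Icc (0 : ℝ) 1, riemannianEDist (𝓡 n) (f x) (γ t) < r := by
    intro t ht
    have hγt : ContMDiffOn 𝓘(ℝ, ℝ) (𝓡 n) 1 γ (Icc 0 t) := hγ.mono (Icc_subset_Icc le_rfl ht.2)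
    calc riemannianEDist (𝓡 n) (f x) (γ t) ≤ pathELength (𝓡 n) γ 0 t :=
          riemannianEDist_le_pathELength hγt h0 rfl ht.1
      _ ≤ pathELength (𝓡 n) γ 0 1 := pathELength_mono le_rfl ht.2
      _ < r := hlen
  set Γ : ℝ → M := fun t => e.toOpenPartialHomeomorph.symm (γ t, (e x).2) with hΓ
  have htgt : ∀ t ∈ Icc (0 : ℝ) 1, (γ t, (e x).2) ∈ e.target := fun t ht =>
    e.mem_target.2 (hr (hball t ht))
  have hΓc : ContinuousOn Γ (Icc 0 1) :=
    e.toOpenPartialHomeomorph.continuousOn_symm.comp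
      (hγ.continuousOn.prodMk continuousOn_const) htgt
  have hfΓ : ∀ t ∈ Icc (0 : ℝ) 1, f (Γ t) = γ t := fun t ht => e.proj_symm_apply (htgt t ht)
  have hsymm : ∀ z, f z ∈ e.baseSet → (e z).2 = (e x).2 →
      e.toOpenPartialHomeomorph.symm (f z, (e x).2) = z := by
    intro z hz hz2
    rw [← hz2]
    exact e.symm_apply_mk_proj (e.mem_source.2 hz)
  have hΓ0 : Γ 0 = x := by
    simp only [hΓ, h0]
    exact hsymm x (h0 ▸ hr (hball 0 (left_mem_Icc.2 zero_le_one))) rfl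
  have hΓ1 : Γ 1 = y := by
    simp only [hΓ, h1]
    exact hsymm y (h1 ▸ hr (hball 1 (right_mem_Icc.2 zero_le_one))) hsheet
  -- The trivialization is only a homeomorphism; smoothness of the lift comes from that of its
  -- projection γ.
  have hΓs : ContMDiffOn 𝓘(ℝ, ℝ) (𝓡 n) 1 Γ (Icc 0 1) := fun t ht =>
    contMDiffWithinAt_of_comp_of_injective_mfderiv hf.contMDiffAt
      (injective_mfderiv_of_norm_mfderiv hiso _) (hΓc t ht)
      ((hγ t ht).congr (fun τ hτ => hfΓ τ hτ) (hfΓ t ht))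
  calc riemannianEDist (𝓡 n) x y ≤ pathELength (𝓡 n) Γ 0 1 :=
        riemannianEDist_le_pathELength hΓs hΓ0 hΓ1 zero_le_one
    _ = pathELength (𝓡 n) (f ∘ Γ) 0 1 := (pathELength_comp_of_norm_mfderiv hf hiso hΓs).symm
    _ = pathELength (𝓡 n) γ 0 1 := pathELength_congr hfΓ
    _ < r := hlen

end LocalIsometryLength

/-! ### The Riemannian distance as a length metric -/

section LengthStructure

variable {n : ℕ}
  {M : Type*} [TopologicalSpace M] [ChartedSpace (EuclideanSpace ℝ (Fin n)) M]
  [IsManifold (𝓡 n) ∞ M] [RiemannianBundle (fun x : M => TangentSpace (𝓡 n) x)]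
  [IsContinuousRiemannianBundle (EuclideanSpace ℝ (Fin n)) (fun x : M => TangentSpace (𝓡 n) x)]

theorem continuous_riemannianEDist_right (x : M) :
    Continuous fun y : M => riemannianEDist (𝓡 n) x y := by
  rw [continuous_iff_continuousAt]
  intro y
  by_cases hy : riemannianEDist (𝓡 n) x y = ⊤
  · have h1 : ∀ᶠ z in 𝓝 y, riemannianEDist (𝓡 n) x z = ⊤ := by
      filter_upwards [eventually_riemannianEDist_lt (𝓡 n) y ENNReal.zero_lt_top] with z hz
      by_contra hxz
      have := riemannianEDist_triangle (I := 𝓡 n) (x := x) (y := z) (z := y)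
      rw [hy, riemannianEDist_comm (x := z), top_le_iff, ENNReal.add_eq_top] at this
      exact this.elim hxz hz.ne
    exact (continuousAt_congr (h1.mono fun z hz => hz)).2 continuousAt_const
  · refine (ENNReal.tendsto_nhds hy).2 fun ε hε => ?_
    filter_upwards [eventually_riemannianEDist_lt (𝓡 n) y hε] with z hz
    constructor
    · rw [tsub_le_iff_right]
      refine riemannianEDist_triangle.trans (add_le_add le_rfl ?_)
      rw [riemannianEDist_comm]
      exact hz.le
    · exact riemannianEDist_triangle.trans (add_le_add le_rfl hz.le)

/-- The Riemannian distance has approximate intermediate points. -/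
theorem exists_riemannianEDist_lt_and_lt {x y : M} {r s : ℝ≥0∞} (hr : 0 < r) (hs : 0 < s)
    (h : riemannianEDist (𝓡 n) x y < r + s) :
    ∃ z, riemannianEDist (𝓡 n) x z < r ∧ riemannianEDist (𝓡 n) z y < s := by
  rcases lt_or_ge (riemannianEDist (𝓡 n) x y) r with hxy | hxy
  · exact ⟨y, hxy, by rwa [riemannianEDist_self]⟩
  obtain ⟨γ, h0, h1, hγ, hlen⟩ := exists_lt_of_riemannianEDist_lt h
  have hrtop : r ≠ ⊤ := fun hrt => by
    rw [hrt, top_le_iff] at hxy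
    simp [hxy] at h
  -- The point sought is where γ reaches distance exactly r' from x: the arc up to it has length at
  -- least r', so less than s remains.
  obtain ⟨r', hr', hr'r⟩ : ∃ r', r' < r ∧ pathELength (𝓡 n) γ 0 1 < r' + s := by
    rcases eq_or_ne s ⊤ with rfl | hst
    · exact ⟨0, hr, by simpa using hlen.trans_le le_top⟩
    · have hc : ContinuousAt (fun q : ℝ≥0∞ => q + s) r := by fun_prop
      have := hc.eventually_const_lt hlen
      have h2 : (𝓝[<] r).NeBot := nhdsLT_neBot_of_exists_lt ⟨0, hr⟩
      obtain ⟨q, hq, hqr⟩ := ((this.filter_mono nhdsWithin_le_nhds).and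
        (self_mem_nhdsWithin (s := Iio r))).exists
      exact ⟨q, hqr, hq⟩
  have hcont : ContinuousOn (fun t => riemannianEDist (𝓡 n) x (γ t)) (Icc (0 : ℝ) 1) :=
    (continuous_riemannianEDist_right x).comp_continuousOn hγ.continuousOn
  obtain ⟨t, ht, hxt⟩ := intermediate_value_Icc zero_le_one hcont (show r' ∈ _ from
    ⟨by simp [h0, riemannianEDist_self], by simpa [h1] using hr'.le.trans hxy⟩)
  simp only at hxt
  refine ⟨γ t, hxt ▸ hr', ?_⟩
  have h2 : r' ≤ pathELength (𝓡 n) γ 0 t := hxt ▸ riemannianEDist_le_pathELength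
    (hγ.mono (Icc_subset_Icc le_rfl ht.2)) h0 rfl ht.1
  have h3 : riemannianEDist (𝓡 n) (γ t) y ≤ pathELength (𝓡 n) γ t 1 :=
    riemannianEDist_le_pathELength (hγ.mono (Icc_subset_Icc ht.1 le_rfl)) rfl h1 ht.2
  rw [← pathELength_add ht.1 ht.2] at hr'r
  refine h3.trans_lt ?_
  by_contra! hcon
  exact absurd (add_le_add h2 hcon) hr'r.not_ge

/-- On a connected manifold the Riemannian distance is finite. -/
theorem riemannianEDist_lt_top [ConnectedSpace M] (x y : M) : riemannianEDist (𝓡 n) x y < ⊤ := by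
  have hopen : IsOpen {y : M | riemannianEDist (𝓡 n) x y < ⊤} :=
    isOpen_Iio.preimage (continuous_riemannianEDist_right x)
  have hclosed : IsClosed {y : M | riemannianEDist (𝓡 n) x y < ⊤} := by
    rw [← isOpen_compl_iff, isOpen_iff_mem_nhds]
    intro y hy
    filter_upwards [eventually_riemannianEDist_lt (𝓡 n) y ENNReal.zero_lt_top] with z hz hxz
    refine hy ((riemannianEDist_triangle (y := z)).trans_lt (ENNReal.add_lt_top.2 ⟨hxz, ?_⟩))
    rwa [riemannianEDist_comm]
  have := IsClopen.eq_univ ⟨hclosed, hopen⟩ ⟨x, by simp [riemannianEDist_self]⟩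
  exact (this ▸ mem_univ y : y ∈ {y : M | riemannianEDist (𝓡 n) x y < ⊤})

end LengthStructure

/-! ### Volumes under local isometries -/

theorem OpenPartialHomeomorph.measurableSet_target_inter_preimage
    {n : ℕ} {M : Type*} [TopologicalSpace M] [MeasurableSpace M] [BorelSpace M]
    (e : OpenPartialHomeomorph M (EuclideanSpace ℝ (Fin n))) {S : Set M} (hS : MeasurableSet S) :
    MeasurableSet (e.target ∩ e.symm ⁻¹' S) := by
  have h : Measurable (e.target.domRestrict e.symm) :=
    (continuousOn_iff_continuous_domRestrict.1 e.continuousOn_symm).measurable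
  have := e.open_target.measurableSet.subtype_image (h hS)
  convert this using 1
  ext y
  simp [and_comm]

namespace SmoothRiemannianMetric

variable {n : ℕ} {M : Type*} [TopologicalSpace M] [ChartedSpace (EuclideanSpace ℝ (Fin n)) M]
  [IsManifold (𝓡 n) ∞ M]

theorem chartVolume_apply [MeasurableSpace M] [BorelSpace M] (g : SmoothRiemannianMetric n M)
    (e : OpenPartialHomeomorph M (EuclideanSpace ℝ (Fin n))) {S : Set M} (hS : MeasurableSet S) :
    g.chartVolume e S =
      ∫⁻ y in e.target ∩ e.symm ⁻¹' S, ENNReal.ofReal √((g.gram e y).det) := by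
  -- `Measure.map` is zero by default without this, and `e.symm` is controlled only on `e.target`.
  have hm : AEMeasurable e.symm (volume.restrict e.target) :=
    e.continuousOn_symm.aemeasurable e.open_target.measurableSet
  rw [chartVolume, Measure.map_apply_of_aemeasurable
    (hm.mono_ac (withDensity_absolutelyContinuous _ _)) hS,
    ← restrict_withDensity e.open_target.measurableSet,
    Measure.restrict_apply' e.open_target.measurableSet, inter_comm,
    withDensity_apply _ (e.measurableSet_target_inter_preimage hS)]

/-- Cauchy–Schwarz, followed by the inequality of arithmetic and geometric means. -/
theorem abs_gram_le (g : SmoothRiemannianMetric n M)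
    (e : OpenPartialHomeomorph M (EuclideanSpace ℝ (Fin n))) (y : EuclideanSpace ℝ (Fin n))
    {C : ℝ} (hC : ∀ i, g.gram e y i i ≤ C) (i j : Fin n) : |g.gram e y i j| ≤ C := by
  let : RiemannianBundle (fun x : M => TangentSpace (𝓡 n) x) := ⟨g.toRiemannianMetric⟩
  set v : Fin n → TangentSpace (𝓡 n) (e.symm y) := fun i =>
    mfderiv (𝓡 n) (𝓡 n) e.symm y (EuclideanSpace.single i (1 : ℝ))
  have hv : ∀ i, ‖v i‖ * ‖v i‖ ≤ C := fun i => by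
    rw [← real_inner_self_eq_norm_mul_norm]; exact hC i
  have h : |inner ℝ (v i) (v j)| ≤ ‖v i‖ * ‖v j‖ := abs_real_inner_le_norm _ _
  refine (show |g.gram e y i j| ≤ ‖v i‖ * ‖v j‖ from h).trans ?_
  nlinarith [hv i, hv j, sq_nonneg (‖v i‖ - ‖v j‖)]

theorem ofReal_sqrt_det_gram_le (g : SmoothRiemannianMetric n M)
    (e : OpenPartialHomeomorph M (EuclideanSpace ℝ (Fin n))) (y : EuclideanSpace ℝ (Fin n))
    {C : ℝ} (hC : ∀ i, g.gram e y i i ≤ C) :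
    ENNReal.ofReal √((g.gram e y).det) ≤ ENNReal.ofReal √(n.factorial * C ^ n) := by
  refine ENNReal.ofReal_le_ofReal (Real.sqrt_le_sqrt ((le_abs_self _).trans ?_))
  have := Matrix.det_le (abv := AbsoluteValue.abs) (A := g.gram e y) (x := C)
    (fun i j => by simpa using abs_gram_le g e y hC i j)
  simpa using this

/-- The volume density is bounded near each point, in the preferred chart at this point. -/
theorem eventually_gram_chartAt_le (g : SmoothRiemannianMetric n M) (x : M) :
    ∃ C : ℝ, ∀ᶠ y in 𝓝 (chartAt (EuclideanSpace ℝ (Fin n)) x x),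
      ∀ i, g.gram (chartAt (EuclideanSpace ℝ (Fin n)) x) y i i ≤ C := by
  let : RiemannianBundle (fun x : M => TangentSpace (𝓡 n) x) := ⟨g.toRiemannianMetric⟩
  have : IsContinuousRiemannianBundle (EuclideanSpace ℝ (Fin n))
      (fun x : M => TangentSpace (𝓡 n) x) :=
    ⟨⟨g.inner, g.toContinuousRiemannianMetric.continuous, fun _ _ _ => rfl⟩⟩
  set e := chartAt (EuclideanSpace ℝ (Fin n)) x with he
  obtain ⟨C, hC0, hC⟩ := eventually_norm_symmL_trivializationAt_lt (EuclideanSpace ℝ (Fin n))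
    (fun x : M => TangentSpace (𝓡 n) x) x
  refine ⟨C ^ 2, ?_⟩
  have hC' : ∀ᶠ y in 𝓝 (e x), ‖(trivializationAt (EuclideanSpace ℝ (Fin n))
      (fun x : M => TangentSpace (𝓡 n) x) x).symmL ℝ (e.symm y)‖ < C :=
    (e.tendsto_symm (mem_chart_source _ x)).eventually hC
  filter_upwards [hC', e.open_target.mem_nhds (mem_chart_target _ x)] with y hy hyt i
  set v : TangentSpace (𝓡 n) (e.symm y) :=
    mfderiv (𝓡 n) (𝓡 n) e.symm y (EuclideanSpace.single i (1 : ℝ)) with hv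
  -- Coordinate fields are the images of constant vectors under the trivialization at x, whose
  -- operator norm is locally bounded.
  have h1 : v = (trivializationAt (EuclideanSpace ℝ (Fin n))
      (fun x : M => TangentSpace (𝓡 n) x) x).symmL ℝ (e.symm y) (EuclideanSpace.single i 1) := by
    rw [TangentBundle.symmL_trivializationAt (e.map_target hyt)]
    have hr : extChartAt (𝓡 n) x (e.symm y) = y := e.right_inv hyt
    rw [hr, ModelWithCorners.range_eq_univ, mfderivWithin_univ]
    rfl
  have h2 : ‖v‖ ≤ C := by
    rw [h1]
    refine (ContinuousLinearMap.le_opNorm _ _).trans ?_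
    rw [PiLp.norm_single, norm_one, mul_one]
    exact hy.le
  calc g.gram e y i i = inner ℝ v v := rfl
    _ = ‖v‖ ^ 2 := real_inner_self_eq_norm_sq _
    _ ≤ C ^ 2 := by gcongr

/-- Each point has a neighborhood of finite volume in the preferred chart at this point. -/
theorem exists_isOpen_lintegral_gram_lt_top (g : SmoothRiemannianMetric n M) (x : M) :
    ∃ W : Set M, IsOpen W ∧ x ∈ W ∧ W ⊆ (chartAt (EuclideanSpace ℝ (Fin n)) x).source ∧
      ∫⁻ y in chartAt (EuclideanSpace ℝ (Fin n)) x '' W,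
        ENNReal.ofReal √((g.gram (chartAt (EuclideanSpace ℝ (Fin n)) x) y).det) < ⊤ := by
  set e := chartAt (EuclideanSpace ℝ (Fin n)) x
  obtain ⟨C, hC⟩ := eventually_gram_chartAt_le g x
  obtain ⟨δ, hδ, hball⟩ := Metric.eventually_nhds_iff_ball.1 hC
  refine ⟨e.source ∩ e ⁻¹' Metric.ball (e x) δ, e.isOpen_inter_preimage Metric.isOpen_ball,
    ⟨mem_chart_source _ x, Metric.mem_ball_self hδ⟩, inter_subset_left, ?_⟩
  have hsub : e '' (e.source ∩ e ⁻¹' Metric.ball (e x) δ) ⊆ Metric.ball (e x) δ := by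
    rintro _ ⟨y, hy, rfl⟩
    exact hy.2
  calc _ ≤ ∫⁻ y in Metric.ball (e x) δ, ENNReal.ofReal √((g.gram e y).det) :=
        lintegral_mono_set hsub
    _ ≤ ∫⁻ _y in Metric.ball (e x) δ, ENNReal.ofReal √(n.factorial * C ^ n) :=
        setLIntegral_mono' Metric.isOpen_ball.measurableSet fun y hy =>
          ofReal_sqrt_det_gram_le g e y (hball y hy)
    _ < ⊤ := by
        rw [setLIntegral_const]
        exact ENNReal.mul_lt_top ENNReal.ofReal_lt_top measure_ball_lt_top

end SmoothRiemannianMetric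

section LocalIsometryVolume

variable {n : ℕ}
  {M : Type*} [TopologicalSpace M] [ChartedSpace (EuclideanSpace ℝ (Fin n)) M]
  [IsManifold (𝓡 n) ∞ M]
  {N : Type*} [TopologicalSpace N] [ChartedSpace (EuclideanSpace ℝ (Fin n)) N]
  [IsManifold (𝓡 n) ∞ N]
  {g : SmoothRiemannianMetric n M} {h : SmoothRiemannianMetric n N} {f : M → N}

/-- With J the Jacobian matrix of f in the charts, the chain rule and the pullback identity give
Gram(g) = Jᵀ Gram(h) J; now take determinants. -/
theorem det_gram_of_pullback (hf : ContMDiff (𝓡 n) (𝓡 n) ∞ f)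
    (hpull : ∀ (x : M) (v w : TangentSpace (𝓡 n) x),
      h.inner (f x) (mfderiv (𝓡 n) (𝓡 n) f x v) (mfderiv (𝓡 n) (𝓡 n) f x w) = g.inner x v w)
    {e' : OpenPartialHomeomorph M (EuclideanSpace ℝ (Fin n))}
    (he' : e' ∈ IsManifold.maximalAtlas (𝓡 n) ∞ M)
    {e : OpenPartialHomeomorph N (EuclideanSpace ℝ (Fin n))}
    (he : e ∈ IsManifold.maximalAtlas (𝓡 n) ∞ N) {y : EuclideanSpace ℝ (Fin n)}
    (hy : y ∈ e'.target) (hy' : f (e'.symm y) ∈ e.source) :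
    ∃ D : EuclideanSpace ℝ (Fin n) →L[ℝ] EuclideanSpace ℝ (Fin n),
      HasFDerivAt (e ∘ f ∘ e'.symm) D y ∧
      (g.gram e' y).det = D.det ^ 2 * (h.gram e (e (f (e'.symm y)))).det := by
  set F := e ∘ f ∘ e'.symm with hF
  have hn : (∞ : ℕ∞ω) ≠ 0 := by simp
  have h1 : MDifferentiableAt (𝓡 n) (𝓡 n) e'.symm y :=
    ((contMDiffOn_symm_of_mem_maximalAtlas he').contMDiffAt
      (e'.open_target.mem_nhds hy)).mdifferentiableAt hn
  have h2 : MDifferentiableAt (𝓡 n) (𝓡 n) f (e'.symm y) := hf.mdifferentiable hn _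
  have h3 : MDifferentiableAt (𝓡 n) (𝓡 n) e (f (e'.symm y)) :=
    ((contMDiffOn_of_mem_maximalAtlas he).contMDiffAt
      (e.open_source.mem_nhds hy')).mdifferentiableAt hn
  have h4 : MDifferentiableAt (𝓡 n) (𝓡 n) e.symm (F y) :=
    ((contMDiffOn_symm_of_mem_maximalAtlas he).contMDiffAt
      (e.open_target.mem_nhds (e.map_source hy'))).mdifferentiableAt hn
  have h12 : MDifferentiableAt (𝓡 n) (𝓡 n) (f ∘ e'.symm) y := h2.comp y h1
  have hFd : MDifferentiableAt (𝓡 n) (𝓡 n) F y := h3.comp y h12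
  have hFd' : DifferentiableAt ℝ F y := mdifferentiableAt_iff_differentiableAt.1 hFd
  refine ⟨fderiv ℝ F y, hFd'.hasFDerivAt, ?_⟩
  set D := fderiv ℝ F y with hD
  have hback : e.symm (F y) = f (e'.symm y) := e.left_inv hy'
  have hchain : ∀ v : EuclideanSpace ℝ (Fin n),
      (mfderiv (𝓡 n) (𝓡 n) f (e'.symm y) (mfderiv (𝓡 n) (𝓡 n) e'.symm y v) :
        EuclideanSpace ℝ (Fin n)) =
      (mfderiv (𝓡 n) (𝓡 n) e.symm (F y) (D v) : EuclideanSpace ℝ (Fin n)) := by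
    intro v
    have hloc : e.symm ∘ F =ᶠ[𝓝 y] f ∘ e'.symm := by
      have hnear : ∀ᶠ z in 𝓝 y, (f ∘ e'.symm) z ∈ e.source :=
        h12.continuousAt (e.open_source.mem_nhds hy')
      filter_upwards [hnear] with z hz
      exact e.left_inv hz
    have e1 := mfderiv_comp y h4 hFd
    have e2 := mfderiv_comp y h2 h1
    have e3 := hloc.mfderiv_eq (I := 𝓡 n) (I' := 𝓡 n)
    have hFD : mfderiv (𝓡 n) (𝓡 n) F y = D := mfderiv_eq_fderiv
    have e1' : (mfderiv (𝓡 n) (𝓡 n) (e.symm ∘ F) y v : EuclideanSpace ℝ (Fin n)) =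
        mfderiv (𝓡 n) (𝓡 n) e.symm (F y) (D v) := by
      rw [e1]
      change mfderiv (𝓡 n) (𝓡 n) e.symm (F y) (mfderiv (𝓡 n) (𝓡 n) F y v) = _
      rw [hFD]
      rfl
    have e2' : (mfderiv (𝓡 n) (𝓡 n) (f ∘ e'.symm) y v : EuclideanSpace ℝ (Fin n)) =
        mfderiv (𝓡 n) (𝓡 n) f (e'.symm y) (mfderiv (𝓡 n) (𝓡 n) e'.symm y v) := by
      rw [e2]; rfl
    rw [← e1', ← e2', e3]
    rfl
  set b := EuclideanSpace.basisFun (Fin n) ℝ with hb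
  set J : Matrix (Fin n) (Fin n) ℝ := LinearMap.toMatrix b.toBasis b.toBasis D.toLinearMap with hJ
  have hgram : g.gram e' y = J.transpose * h.gram e (F y) * J := by
    ext i j
    have hexp : ∀ i, D (EuclideanSpace.single i (1 : ℝ)) =
        ∑ k, J k i • EuclideanSpace.single k (1 : ℝ) := by
      intro i
      have := b.toBasis.sum_repr (D (EuclideanSpace.single i (1 : ℝ)))
      rw [← this]
      simp [hJ, LinearMap.toMatrix_apply, hb]
    -- The base points `e.symm (F y)` and `f (e'.symm y)` are only propositionally equal; vectors
    -- are kept in the common model space to pass between them.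
    have hinner : ∀ (p q : N) (_ : p = q) (v w : EuclideanSpace ℝ (Fin n)),
        h.inner p v w = h.inner q v w := by
      rintro p q rfl v w; rfl
    have hG : ∀ k l, h.gram e (F y) k l = h.inner (f (e'.symm y))
        (mfderiv (𝓡 n) (𝓡 n) e.symm (F y) (EuclideanSpace.single k (1 : ℝ)) :
          EuclideanSpace ℝ (Fin n))
        (mfderiv (𝓡 n) (𝓡 n) e.symm (F y) (EuclideanSpace.single l (1 : ℝ)) :
          EuclideanSpace ℝ (Fin n)) := fun k l => hinner _ _ hback _ _
    set T : EuclideanSpace ℝ (Fin n) →L[ℝ] EuclideanSpace ℝ (Fin n) :=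
      mfderiv (𝓡 n) (𝓡 n) e.symm (F y) with hT
    set B : EuclideanSpace ℝ (Fin n) →L[ℝ] EuclideanSpace ℝ (Fin n) →L[ℝ] ℝ :=
      h.inner (f (e'.symm y)) with hB
    have hLHS : g.gram e' y i j = B (T (D (EuclideanSpace.single i (1 : ℝ))))
        (T (D (EuclideanSpace.single j (1 : ℝ)))) := by
      change g.inner (e'.symm y) _ _ = _
      rw [← hpull]
      have c1 := hchain (EuclideanSpace.single i (1 : ℝ))
      have c2 := hchain (EuclideanSpace.single j (1 : ℝ))
      exact congrArg₂ (fun v w => B v w) c1 c2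
    have hG' : ∀ k l, h.gram e (F y) k l = B (T (EuclideanSpace.single k (1 : ℝ)))
        (T (EuclideanSpace.single l (1 : ℝ))) := hG
    rw [hLHS, hexp, hexp]
    simp only [map_sum, map_smul, sum_apply, smul_apply,
      smul_eq_mul, Matrix.mul_apply, Matrix.transpose_apply, hG', Finset.sum_mul, Finset.mul_sum]
    refine Finset.sum_congr rfl fun k _ => Finset.sum_congr rfl fun l _ => ?_
    ring
  have hdet : J.det = D.det := LinearMap.det_toMatrix _ _
  rw [hgram, Matrix.det_mul, Matrix.det_mul, Matrix.det_transpose, hdet]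
  change _ = D.det ^ 2 * (h.gram e (F y)).det
  ring

variable [MeasurableSpace M] [BorelSpace M]

/-- Change of variables, the Jacobian factor being absorbed by the density. Only an inequality, as S
may leave the domain of `e'`. -/
theorem chartVolume_of_injOn_of_pullback (hf : ContMDiff (𝓡 n) (𝓡 n) ∞ f)
    (hpull : ∀ (x : M) (v w : TangentSpace (𝓡 n) x),
      h.inner (f x) (mfderiv (𝓡 n) (𝓡 n) f x v) (mfderiv (𝓡 n) (𝓡 n) f x w) = g.inner x v w)
    {e' : OpenPartialHomeomorph M (EuclideanSpace ℝ (Fin n))}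
    (he' : e' ∈ IsManifold.maximalAtlas (𝓡 n) ∞ M)
    {e : OpenPartialHomeomorph N (EuclideanSpace ℝ (Fin n))}
    (he : e ∈ IsManifold.maximalAtlas (𝓡 n) ∞ N) {S : Set M} (hS : MeasurableSet S)
    (hinj : InjOn f S) (hSe : MapsTo f S e.source) :
    g.chartVolume e' S ≤
      ∫⁻ y in e '' (f '' S), ENNReal.ofReal √((h.gram e y).det) := by
  rw [SmoothRiemannianMetric.chartVolume_apply g e' hS]
  set T := e'.target ∩ e'.symm ⁻¹' S with hT
  have hTm : MeasurableSet T := e'.measurableSet_target_inter_preimage hS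
  set F := e ∘ f ∘ e'.symm with hF
  have hex : ∀ y : EuclideanSpace ℝ (Fin n), ∃ D : EuclideanSpace ℝ (Fin n) →L[ℝ]
      EuclideanSpace ℝ (Fin n), y ∈ T → HasFDerivAt F D y ∧
      (g.gram e' y).det = D.det ^ 2 * (h.gram e (F y)).det := by
    intro y
    by_cases hy : y ∈ T
    · obtain ⟨D, hD⟩ := det_gram_of_pullback hf hpull he' he hy.1 (hSe hy.2)
      exact ⟨D, fun _ => hD⟩
    · exact ⟨0, fun h => (hy h).elim⟩
  choose D hD using hex
  have hFinj : InjOn F T := by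
    intro y hy z hz hyz
    have h1 := e.injOn (hSe hy.2) (hSe hz.2) hyz
    exact e'.symm.injOn hy.1 hz.1 (hinj hy.2 hz.2 h1)
  have key := lintegral_image_eq_lintegral_abs_det_fderiv_mul volume hTm
    (fun y hy => (hD y hy).1.hasFDerivWithinAt) hFinj
    (fun y => ENNReal.ofReal √((h.gram e y).det))
  calc ∫⁻ y in T, ENNReal.ofReal √((g.gram e' y).det)
      = ∫⁻ y in T, ENNReal.ofReal |(D y).det| * ENNReal.ofReal √((h.gram e (F y)).det) := by
        refine setLIntegral_congr_fun hTm fun y hy => ?_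
        simp only [(hD y hy).2]
        rw [Real.sqrt_mul (sq_nonneg _), Real.sqrt_sq_eq_abs, ENNReal.ofReal_mul (abs_nonneg _)]
    _ = ∫⁻ y in F '' T, ENNReal.ofReal √((h.gram e y).det) := key.symm
    _ ≤ _ := by
        refine lintegral_mono_set ?_
        rintro _ ⟨y, hy, rfl⟩
        exact ⟨_, ⟨_, hy.2, rfl⟩, rfl⟩

/-- The volume of an open set on which a local isometry is injective is bounded by the volume of
its image in a chart. -/
theorem vol_le_of_injOn_of_pullback (hf : ContMDiff (𝓡 n) (𝓡 n) ∞ f) (hopen : IsOpenMap f)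
    (hpull : ∀ (x : M) (v w : TangentSpace (𝓡 n) x),
      h.inner (f x) (mfderiv (𝓡 n) (𝓡 n) f x v) (mfderiv (𝓡 n) (𝓡 n) f x w) = g.inner x v w)
    {e : OpenPartialHomeomorph N (EuclideanSpace ℝ (Fin n))}
    (he : e ∈ IsManifold.maximalAtlas (𝓡 n) ∞ N) {A : Set M} (hA : IsOpen A)
    (hinj : InjOn f A) {W : Set N} (hAW : MapsTo f A W) (hW : W ⊆ e.source) :
    g.vol A ≤ ∫⁻ y in e '' W, ENNReal.ofReal √((h.gram e y).det) := by
  have hAe : MapsTo f A e.source := hAW.mono_right hW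
  set φ : A → EuclideanSpace ℝ (Fin n) := fun a => e (f a) with hφ
  have hemb : MeasurableEmbedding φ := by
    refine (Topology.IsOpenEmbedding.of_continuous_injective_isOpenMap ?_ ?_ ?_).measurableEmbedding
    · exact (e.continuousOn.comp hf.continuous.continuousOn hAe).domRestrict
    · intro a b hab
      exact Subtype.ext (hinj a.2 b.2 (e.injOn (hAe a.2) (hAe b.2) hab))
    · intro V hV
      have h1 : IsOpen (f '' (Subtype.val '' V)) := hopen _ (hA.isOpenMap_subtype_val V hV)
      have h2 : f '' (Subtype.val '' V) ⊆ e.source := by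
        rintro _ ⟨_, ⟨a, -, rfl⟩, rfl⟩
        exact hAe a.2
      have h3 := e.isOpen_image_of_subset_source h1 h2
      rwa [image_image, image_image] at h3
  set μ : Measure (EuclideanSpace ℝ (Fin n)) :=
    volume.withDensity fun y => ENNReal.ofReal √((h.gram e y).det) with hμ
  -- As `g.vol` is a supremum, any measure dominating all chart volumes bounds it. Infinite mass on
  -- nonempty sets off A makes domination trivial except for subsets of A.
  set ν : Measure M := (μ.comap φ).map Subtype.val + (⊤ : Measure M).restrict Aᶜ with hν
  have himage : ∀ S : Set M, MeasurableSet S → S ⊆ A → MeasurableSet (e '' (f '' S)) ∧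
      (μ.comap φ).map Subtype.val S =
        ∫⁻ y in e '' (f '' S), ENNReal.ofReal √((h.gram e y).det) := by
    intro S hS hSA
    have him : φ '' (Subtype.val ⁻¹' S) = e '' (f '' S) := by
      rw [image_image]
      ext z
      constructor
      · rintro ⟨a, ha, rfl⟩
        exact ⟨a, ha, rfl⟩
      · rintro ⟨a, ha, rfl⟩
        exact ⟨⟨a, hSA ha⟩, ha, rfl⟩
    have hmeas : MeasurableSet (e '' (f '' S)) := by
      rw [← him]
      exact hemb.measurableSet_image.2 (measurable_subtype_coe hS)
    refine ⟨hmeas, ?_⟩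
    rw [Measure.map_apply measurable_subtype_coe hS, hemb.comap_apply, him, hμ,
      withDensity_apply _ hmeas]
  have hle : g.vol ≤ ν := by
    refine iSup₂_le fun e' he' => Measure.le_iff.2 fun S hS => ?_
    by_cases hSA : S ⊆ A
    · calc g.chartVolume e' S ≤ ∫⁻ y in e '' (f '' S), ENNReal.ofReal √((h.gram e y).det) :=
            chartVolume_of_injOn_of_pullback hf hpull he' he hS (hinj.mono hSA) (hAe.mono_left hSA)
        _ = (μ.comap φ).map Subtype.val S := (himage S hS hSA).2.symm
        _ ≤ ν S := by
            rw [hν, Measure.add_apply]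
            exact le_self_add
    · have hne : (S ∩ Aᶜ).Nonempty := by
        obtain ⟨x, hx, hxA⟩ := not_subset.1 hSA
        exact ⟨x, hx, hxA⟩
      have : ν S = ⊤ := by
        rw [hν, Measure.add_apply, Measure.restrict_apply hS, ← Measure.coe_toOuterMeasure ⊤,
          Measure.toOuterMeasure_top, OuterMeasure.top_apply hne, add_top]
      rw [this]
      exact le_top
  calc g.vol A ≤ ν A := hle A
    _ = ∫⁻ y in e '' (f '' A), ENNReal.ofReal √((h.gram e y).det) := by
        rw [hν, Measure.add_apply, (himage A hA.measurableSet subset_rfl).2,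
          Measure.restrict_apply hA.measurableSet]
        simp
    _ ≤ _ := lintegral_mono_set (image_mono (image_subset_iff.2 hAW))

end LocalIsometryVolume

/-! ### The distance of a Riemannian metric -/

namespace SmoothRiemannianMetric

variable {n : ℕ} {M : Type*} [TopologicalSpace M] [ChartedSpace (EuclideanSpace ℝ (Fin n)) M]
  [IsManifold (𝓡 n) ∞ M] (g : SmoothRiemannianMetric n M)

/-- The norm on the tangent spaces which is associated with `g`. -/
@[reducible] noncomputable def toRiemannianBundle : RiemannianBundle (fun x : M => TangentSpace (𝓡 n) x) :=
  ⟨g.toRiemannianMetric⟩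

theorem isContinuousRiemannianBundle :
    letI := g.toRiemannianBundle
    IsContinuousRiemannianBundle (EuclideanSpace ℝ (Fin n))
      (fun x : M => TangentSpace (𝓡 n) x) :=
  letI := g.toRiemannianBundle
  ⟨⟨g.inner, g.toContinuousRiemannianMetric.continuous, fun _ _ _ => rfl⟩⟩

theorem norm_eq_sqrt_inner (x : M) (v : TangentSpace (𝓡 n) x) :
    letI := g.toRiemannianBundle
    ‖v‖ = √(g.inner x v v) := by
  let := g.toRiemannianBundle
  exact norm_eq_sqrt_real_inner v

theorem enorm_scale (c : ℝ) (hc : 0 < c) (x : M) (v : TangentSpace (𝓡 n) x) :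
    (letI := (g.scale c hc).toRiemannianBundle; ‖v‖ₑ) =
      ENNReal.ofReal √c * (letI := g.toRiemannianBundle; ‖v‖ₑ) := by
  have h1 : (letI := (g.scale c hc).toRiemannianBundle; ‖v‖ₑ) =
      ENNReal.ofReal √((g.scale c hc).inner x v v) := by
    rw [← norm_eq_sqrt_inner]
    exact (@ofReal_norm _ (_) v).symm
  have h2 : (letI := g.toRiemannianBundle; ‖v‖ₑ) = ENNReal.ofReal √(g.inner x v v) := by
    rw [← norm_eq_sqrt_inner]
    exact (@ofReal_norm _ (_) v).symm
  rw [h1, h2, ← ENNReal.ofReal_mul (Real.sqrt_nonneg c), ← Real.sqrt_mul hc.le]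
  rfl

/-- All lengths are multiplied by √c, and a factor other than 0 and ⊤ commutes with infima. -/
theorem edist_scale (c : ℝ) (hc : 0 < c) (x y : M) :
    (g.scale c hc).edist x y = ENNReal.ofReal √c * g.edist x y := by
  have h0 : ENNReal.ofReal √c ≠ 0 := by simpa using hc
  have htop : ENNReal.ofReal √c ≠ ⊤ := ENNReal.ofReal_ne_top
  simp only [edist, riemannianEDist]
  rw [ENNReal.mul_iInf_of_ne h0 htop]
  refine iInf_congr fun γ => ?_
  rw [ENNReal.mul_iInf_of_ne h0 htop]
  refine iInf_congr fun _ => ?_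
  rw [← lintegral_const_mul' _ _ htop]
  exact lintegral_congr fun t => g.enorm_scale c hc _ _

theorem dist_scale (c : ℝ) (hc : 0 < c) (x y : M) :
    (g.scale c hc).dist x y = √c * g.dist x y := by
  rw [dist, dist, edist_scale, ENNReal.toReal_mul, ENNReal.toReal_ofReal (Real.sqrt_nonneg c)]

theorem edist_self (x : M) : g.edist x x = 0 := by
  let := g.toRiemannianBundle
  exact riemannianEDist_self

theorem edist_comm (x y : M) : g.edist x y = g.edist y x := by
  let := g.toRiemannianBundle
  exact riemannianEDist_comm

theorem edist_triangle (x y z : M) : g.edist x z ≤ g.edist x y + g.edist y z := by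
  let := g.toRiemannianBundle
  exact riemannianEDist_triangle

theorem eventually_edist_lt (x : M) {r : ℝ≥0∞} (hr : 0 < r) : ∀ᶠ y in 𝓝 x, g.edist x y < r := by
  let := g.toRiemannianBundle
  have := g.isContinuousRiemannianBundle
  exact eventually_riemannianEDist_lt (𝓡 n) x hr

theorem exists_edist_lt_subset [RegularSpace M] {x : M} {s : Set M} (hs : s ∈ 𝓝 x) :
    ∃ r : ℝ≥0∞, 0 < r ∧ {y | g.edist x y < r} ⊆ s := by
  let := g.toRiemannianBundle
  have := g.isContinuousRiemannianBundle
  exact setOfPred_riemannianEDist_lt_subset_nhds' (𝓡 n) hs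

theorem dist_comm (x y : M) : g.dist x y = g.dist y x := by
  rw [dist, edist_comm, dist]

theorem dist_nonneg (x y : M) : 0 ≤ g.dist x y := ENNReal.toReal_nonneg

theorem exists_finset_edist_lt [CompactSpace M] {r : M → ℝ≥0∞} (hr : ∀ x, 0 < r x) :
    ∃ t : Finset M, ∀ y, ∃ x ∈ t, g.edist x y < r x := by
  obtain ⟨t, ht⟩ := CompactSpace.elim_nhds_subcover (fun x => {y | g.edist x y < r x})
    fun x => g.eventually_edist_lt x (hr x)
  refine ⟨t, fun y => ?_⟩
  have : y ∈ ⋃ x ∈ t, {y | g.edist x y < r x} := ht ▸ mem_univ y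
  simpa using this

/-- A Lebesgue number, in terms of the Riemannian distance, with control on the members of the
covering that are used. -/
theorem exists_lebesgue_number [CompactSpace M] [RegularSpace M] {O : M → Set M}
    (hO : ∀ x, O x ∈ 𝓝 x) :
    ∃ (t : Finset M) (r : ℝ≥0∞), 0 < r ∧ ∀ x, ∃ q ∈ t, {y | g.edist x y < r} ⊆ O q := by
  choose r hr hrO using fun x => g.exists_edist_lt_subset (hO x)
  obtain ⟨t, ht⟩ := g.exists_finset_edist_lt (r := fun x => r x / 2)
    fun x => ENNReal.half_pos (hr x).ne'
  -- Half radii leave room for the triangle inequality; over an empty `t` the infimum is ⊤, still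
  -- positive.
  refine ⟨t, t.inf fun x => r x / 2, ?_, fun x => ?_⟩
  · rw [Finset.lt_inf_iff ENNReal.zero_lt_top]
    exact fun x _ => ENNReal.half_pos (hr x).ne'
  · obtain ⟨q, hq, hqx⟩ := ht x
    refine ⟨q, hq, fun y hy => hrO q ?_⟩
    have hy' : g.edist x y < r q / 2 := lt_of_lt_of_le hy (Finset.inf_le hq)
    calc g.edist q y ≤ g.edist q x + g.edist x y := g.edist_triangle _ _ _
      _ < r q / 2 + r q / 2 := ENNReal.add_lt_add hqx hy'
      _ = r q := ENNReal.add_halves _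

section Connected

variable [ConnectedSpace M]

theorem edist_lt_top (x y : M) : g.edist x y < ⊤ := by
  let := g.toRiemannianBundle
  have := g.isContinuousRiemannianBundle
  exact riemannianEDist_lt_top x y

theorem edist_lt_ofReal_iff {x y : M} {r : ℝ} :
    g.edist x y < ENNReal.ofReal r ↔ g.dist x y < r :=
  ENNReal.lt_ofReal_iff_toReal_lt (g.edist_lt_top x y).ne

theorem dist_triangle (x y z : M) : g.dist x z ≤ g.dist x y + g.dist y z := by
  have hxy := (g.edist_lt_top x y).ne
  have hyz := (g.edist_lt_top y z).ne
  rw [dist, dist, dist, ← ENNReal.toReal_add hxy hyz]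
  exact ENNReal.toReal_mono (ENNReal.add_ne_top.2 ⟨hxy, hyz⟩) (g.edist_triangle x y z)

theorem exists_dist_lt_and_lt (x y : M) (r s : ℝ) (hr : 0 < r) (hs : 0 < s)
    (h : g.dist x y < r + s) : ∃ z, g.dist x z < r ∧ g.dist z y < s := by
  let := g.toRiemannianBundle
  have := g.isContinuousRiemannianBundle
  rw [← edist_lt_ofReal_iff, ENNReal.ofReal_add hr.le hs.le] at h
  obtain ⟨z, h1, h2⟩ := exists_riemannianEDist_lt_and_lt (ENNReal.ofReal_pos.2 hr)
    (ENNReal.ofReal_pos.2 hs) h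
  exact ⟨z, g.edist_lt_ofReal_iff.1 h1, g.edist_lt_ofReal_iff.1 h2⟩

end Connected

end SmoothRiemannianMetric

/-! ### Uniform geometry of Riemannian coverings of compact manifolds -/

namespace IsRiemannianCovering

variable {n : ℕ}
  {M : Type*} [TopologicalSpace M] [ChartedSpace (EuclideanSpace ℝ (Fin n)) M]
  [IsManifold (𝓡 n) ∞ M]
  {N : Type*} [TopologicalSpace N] [ChartedSpace (EuclideanSpace ℝ (Fin n)) N]
  [IsManifold (𝓡 n) ∞ N]
  {g : SmoothRiemannianMetric n M} {h : SmoothRiemannianMetric n N} {f : M → N}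

theorem norm_mfderiv (hf : IsRiemannianCovering g h f) (x : M) (v : TangentSpace (𝓡 n) x) :
    letI := g.toRiemannianBundle
    letI := h.toRiemannianBundle
    ‖mfderiv (𝓡 n) (𝓡 n) f x v‖ = ‖v‖ := by
  rw [SmoothRiemannianMetric.norm_eq_sqrt_inner, SmoothRiemannianMetric.norm_eq_sqrt_inner,
    hf.pullback]

theorem mem_sheet (hf : IsRiemannianCovering g h f) {ι : Type*} [TopologicalSpace ι]
    [DiscreteTopology ι] (e : Trivialization ι f) {x y : M} {r : ℝ≥0∞}
    (hr : {q | h.edist (f x) q < r} ⊆ e.baseSet) (hxy : g.edist x y < r) :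
    h.edist (f x) (f y) < r ∧ (e y).2 = (e x).2 := by
  let := g.toRiemannianBundle
  let := h.toRiemannianBundle
  exact mem_sheet_of_riemannianEDist_lt (hf.contMDiff.of_le (by simp)) hf.norm_mfderiv e hr hxy

theorem edist_lt_of_mem_sheet (hf : IsRiemannianCovering g h f) {ι : Type*} [TopologicalSpace ι]
    (e : Trivialization ι f) {x y : M} {r : ℝ≥0∞}
    (hr : {q | h.edist (f x) q < r} ⊆ e.baseSet) (hxy : h.edist (f x) (f y) < r)
    (hsheet : (e y).2 = (e x).2) : g.edist x y < r := by
  let := g.toRiemannianBundle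
  let := h.toRiemannianBundle
  exact riemannianEDist_lt_of_mem_sheet (hf.contMDiff.of_le (by simp)) hf.norm_mfderiv e hr hxy
    hsheet

/-- The volume of a ball which projects into a nice chart domain is bounded by the volume of this
chart domain. -/
theorem vol_ball_le [MeasurableSpace M] [BorelSpace M] (hf : IsRiemannianCovering g h f)
    {ι : Type*} [TopologicalSpace ι] [DiscreteTopology ι] (e : Trivialization ι f)
    {k : OpenPartialHomeomorph N (EuclideanSpace ℝ (Fin n))}
    (hk : k ∈ IsManifold.maximalAtlas (𝓡 n) ∞ N) {W : Set N} (hW : IsOpen W) (hWk : W ⊆ k.source)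
    {x : M} {r : ℝ} (hr : {q | h.edist (f x) q < ENNReal.ofReal r} ⊆ e.baseSet ∩ W) :
    g.vol (g.ball x r) ≤ ∫⁻ y in k '' W, ENNReal.ofReal √((h.gram k y).det) := by
  -- The part over W of the sheet through x, where f is injective.
  set A : Set M := e.source ∩ e ⁻¹' (W ×ˢ {(e x).2}) with hA
  have hAopen : IsOpen A :=
    e.continuousOn_toFun.isOpen_inter_preimage e.open_source (hW.prod (isOpen_discrete _))
  have hinj : InjOn f A := by
    intro y hy z hz hyz
    refine e.injOn hy.1 hz.1 (Prod.ext ?_ ?_)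
    · exact (e.coe_fst hy.1).trans (hyz.trans (e.coe_fst hz.1).symm)
    · exact hy.2.2.trans hz.2.2.symm
  have hAW : MapsTo f A W := fun y hy => e.coe_fst hy.1 ▸ hy.2.1
  have hball : g.ball x r ⊆ A := by
    intro y hy
    obtain ⟨h1, h2⟩ := hf.mem_sheet e (hr.trans inter_subset_left) hy
    have hsrc : y ∈ e.source := e.mem_source.2 (hr h1).1
    refine ⟨hsrc, ?_, h2⟩
    rw [e.coe_fst hsrc]
    exact (hr h1).2
  exact (measure_mono hball).trans (vol_le_of_injOn_of_pullback hf.contMDiff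
    hf.isCoveringMap.isOpenMap hf.pullback hk hAopen hinj hAW hWk)

/-- A Riemannian covering of a compact manifold has uniformly bounded geometry: at some scale, the
volumes of balls are bounded and balls are doubling. -/
theorem exists_uniform_bounds [ConnectedSpace M] [MeasurableSpace M] [BorelSpace M]
    [T2Space N] [CompactSpace N] (hf : IsRiemannianCovering g h f) :
    ∃ (ρ K : ℝ) (V : ℝ≥0∞), 0 < ρ ∧ 1 ≤ K ∧ V < ⊤ ∧ (∀ x, g.vol (g.ball x ρ) ≤ V) ∧
      ∀ x, CoveredByBalls g.dist {y | g.dist x y < 2 * ρ} ρ K := by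
  classical
  have hfib : ∀ q : N, Nonempty (f ⁻¹' {q}) := fun q =>
    let ⟨x, hx⟩ := hf.surjective q
    ⟨⟨x, hx⟩⟩
  have hdisc : ∀ q : N, DiscreteTopology (f ⁻¹' {q}) := fun q => (hf.isCoveringMap q).1
  let e : ∀ q : N, Trivialization (f ⁻¹' {q}) f := fun q => (hf.isCoveringMap q).toTrivialization
  have he : ∀ q, q ∈ (e q).baseSet := fun q =>
    (hf.isCoveringMap q).mem_toTrivialization_baseSet
  choose W hWo hqW hWs hWfin using fun q => h.exists_isOpen_lintegral_gram_lt_top q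
  obtain ⟨t, δ, hδ, ht⟩ := h.exists_lebesgue_number (O := fun q => (e q).baseSet ∩ W q) fun q =>
    inter_mem ((e q).open_baseSet.mem_nhds (he q)) ((hWo q).mem_nhds (hqW q))
  -- The radius 3ρ = 2ρ + ρ accommodates a ρ-ball centred in a 2ρ-ball; the minimum with 1 handles δ
  -- = ⊤.
  obtain ⟨ρ, hρ, hρδ⟩ : ∃ ρ : ℝ, 0 < ρ ∧ ENNReal.ofReal (3 * ρ) ≤ δ := by
    have h1 : min δ 1 ≠ ⊤ := ne_top_of_le_ne_top ENNReal.one_ne_top (min_le_right _ _)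
    refine ⟨(min δ 1).toReal / 3, ?_, ?_⟩
    · have := ENNReal.toReal_pos (lt_min hδ one_pos).ne' h1
      positivity
    · rw [mul_div_cancel₀ _ (by norm_num : (3 : ℝ) ≠ 0), ENNReal.ofReal_toReal h1]
      exact min_le_left _ _
  have ht' : ∀ x : N, ∃ q ∈ t,
      {y | h.edist x y < ENNReal.ofReal (3 * ρ)} ⊆ (e q).baseSet ∩ W q := fun x =>
    let ⟨q, hq, hqO⟩ := ht x
    ⟨q, hq, fun y hy => hqO (lt_of_lt_of_le hy hρδ)⟩
  -- The size of one finite ρ/2-net of N bounds the covering numbers in M uniformly.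
  obtain ⟨s, hs⟩ := h.exists_finset_edist_lt (r := fun _ => ENNReal.ofReal (ρ / 2))
    fun _ => ENNReal.ofReal_pos.2 (by positivity)
  refine ⟨ρ, s.card + 1, t.sup fun q => ∫⁻ y in chartAt (EuclideanSpace ℝ (Fin n)) q '' W q,
    ENNReal.ofReal √((h.gram (chartAt (EuclideanSpace ℝ (Fin n)) q) y).det), hρ, by simp,
    (Finset.sup_lt_iff ENNReal.zero_lt_top).2 fun q _ => hWfin q, fun x => ?_, fun x => ?_⟩
  · obtain ⟨q, hq, hqO⟩ := ht' (f x)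
    refine (hf.vol_ball_le (e q) (IsManifold.chart_mem_maximalAtlas q) (hWo q) (hWs q)
      (fun y hy => hqO ?_)).trans (Finset.le_sup (f := fun q =>
        ∫⁻ y in chartAt (EuclideanSpace ℝ (Fin n)) q '' W q,
        ENNReal.ofReal √((h.gram (chartAt (EuclideanSpace ℝ (Fin n)) q) y).det)) hq)
    exact lt_of_lt_of_le hy (ENNReal.ofReal_le_ofReal (by linarith))
  · obtain ⟨q, -, hqO⟩ := ht' (f x)
    have hsheet : ∀ y, g.dist x y < 2 * ρ →
        h.edist (f x) (f y) < ENNReal.ofReal (2 * ρ) ∧ (e q y).2 = (e q x).2 := by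
      intro y hy
      refine hf.mem_sheet (e q) (fun z hz => (hqO ?_).1) (g.edist_lt_ofReal_iff.2 hy)
      exact lt_of_lt_of_le hz (ENNReal.ofReal_le_ofReal (by linarith))
    -- One point of the 2ρ-ball is chosen over each ρ/2-ball of the net that the projection meets.
    -- Points of the 2ρ-ball over the same net ball share a sheet and project ρ-close, so they are
    -- ρ-close in M.
    have hch : ∀ p : N, ∃ z, g.dist x z < 2 * ρ ∧ ((∃ z', g.dist x z' < 2 * ρ ∧
        h.edist p (f z') < ENNReal.ofReal (ρ / 2)) → h.edist p (f z) < ENNReal.ofReal (ρ / 2)) := by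
      intro p
      by_cases hp : ∃ z', g.dist x z' < 2 * ρ ∧ h.edist p (f z') < ENNReal.ofReal (ρ / 2)
      · obtain ⟨z, hz, hz'⟩ := hp
        exact ⟨z, hz, fun _ => hz'⟩
      · exact ⟨x, by rw [SmoothRiemannianMetric.dist, g.edist_self]; simpa using hρ,
          fun h => (hp h).elim⟩
    choose z hz hzp using hch
    refine ⟨s.image z, ?_, fun y hy => ?_⟩
    · have : ((s.image z).card : ℝ) ≤ s.card := by exact_mod_cast Finset.card_image_le
      linarith
    · obtain ⟨p, hp, hpy⟩ := hs (f y)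
      refine ⟨z p, Finset.mem_image_of_mem _ hp, ?_⟩
      have h1 := hzp p ⟨y, hy, hpy⟩
      obtain ⟨h2, h3⟩ := hsheet _ (hz p)
      obtain ⟨-, h4⟩ := hsheet _ hy
      rw [← g.edist_lt_ofReal_iff]
      refine hf.edist_lt_of_mem_sheet (e q) (fun w hw => (hqO ?_).1) ?_ (h4.trans h3.symm)
      · calc h.edist (f x) w ≤ h.edist (f x) (f (z p)) + h.edist (f (z p)) w :=
              h.edist_triangle _ _ _
          _ < ENNReal.ofReal (2 * ρ) + ENNReal.ofReal ρ := ENNReal.add_lt_add h2 hw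
          _ = ENNReal.ofReal (3 * ρ) := by
              rw [← ENNReal.ofReal_add (by positivity) hρ.le]
              ring_nf
      · calc h.edist (f (z p)) (f y) ≤ h.edist (f (z p)) p + h.edist p (f y) :=
              h.edist_triangle _ _ _
          _ < ENNReal.ofReal (ρ / 2) + ENNReal.ofReal (ρ / 2) :=
              ENNReal.add_lt_add (h.edist_comm p _ ▸ h1) hpy
          _ = ENNReal.ofReal ρ := by
              rw [← ENNReal.ofReal_add (by positivity) (by positivity), add_halves]

end IsRiemannianCovering

/-! ### Volume entropy and covering growth -/

namespace SmoothRiemannianMetric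

variable {n : ℕ} {M : Type*} [TopologicalSpace M] [ChartedSpace (EuclideanSpace ℝ (Fin n)) M]
  [IsManifold (𝓡 n) ∞ M] [MeasurableSpace M] (g : SmoothRiemannianMetric n M)

theorem vol_ball_le_of_coveredByBalls [ConnectedSpace M] {ρ : ℝ} {V : ℝ≥0∞}
    (hV : ∀ x, g.vol (g.ball x ρ) ≤ V) {p : M} {R m : ℝ}
    (hcov : CoveredByBalls g.dist {x | g.dist p x < R} ρ m) :
    g.vol (g.ball p R) ≤ ENNReal.ofReal m * V := by
  obtain ⟨s, hs, hsB⟩ := hcov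
  have hsub : g.ball p R ⊆ ⋃ y ∈ s, g.ball y ρ := by
    intro x hx
    obtain ⟨y, hy, hyx⟩ := hsB x (g.edist_lt_ofReal_iff.1 hx)
    exact mem_iUnion₂.2 ⟨y, hy, g.edist_lt_ofReal_iff.2 hyx⟩
  calc g.vol (g.ball p R) ≤ ∑ y ∈ s, g.vol (g.ball y ρ) :=
        (measure_mono hsub).trans (measure_biUnion_finset_le _ _)
    _ ≤ ∑ _y ∈ s, V := Finset.sum_le_sum fun y _ => hV y
    _ = s.card * V := by simp
    _ ≤ ENNReal.ofReal m * V := by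
        gcongr
        rw [← ENNReal.ofReal_natCast]
        exact ENNReal.ofReal_le_ofReal hs

theorem upperVolumeEntropy_le_of_vol_ball_le {p : M} {a B : ℝ} (hB : 0 < B)
    (h : ∀ R : ℝ, 0 ≤ R → g.vol (g.ball p R) ≤ ENNReal.ofReal (B * Real.exp (a * R))) :
    g.upperVolumeEntropy p ≤ (a : EReal) := by
  have hlim : Tendsto (fun R : ℝ => ((Real.log B / R + a : ℝ) : EReal)) atTop (𝓝 (a : EReal)) := by
    refine EReal.tendsto_coe.2 ?_
    simpa using (tendsto_const_nhds.div_atTop tendsto_id).add_const a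
  rw [upperVolumeEntropy, ← hlim.limsup_eq]
  refine limsup_le_limsup ?_
  filter_upwards [eventually_gt_atTop 0] with R hR
  have h1 : ENNReal.log (g.vol (g.ball p R)) ≤ ((Real.log B + a * R : ℝ) : EReal) := by
    refine (ENNReal.log_monotone (h R hR.le)).trans_eq ?_
    rw [ENNReal.log_ofReal_of_pos (by positivity),
      Real.log_mul hB.ne' (Real.exp_pos _).ne', Real.log_exp]
  calc ENNReal.log (g.vol (g.ball p R)) / (R : EReal)
      ≤ ((Real.log B + a * R : ℝ) : EReal) / (R : EReal) :=
        EReal.div_le_div_right_of_nonneg (by exact_mod_cast hR.le) h1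
    _ = ((Real.log B / R + a : ℝ) : EReal) := by
        rw [← EReal.coe_div]
        congr 1
        field_simp

/-- Under a uniform bound on the volumes of balls and a doubling property at some scale, the volume
entropy is at most the growth rate of coverings. -/
theorem upperVolumeEntropy_le_of_hasCoveringGrowth [ConnectedSpace M]
    {ρ K : ℝ} {V : ℝ≥0∞} (hρ : 0 < ρ) (hK : 1 ≤ K)
    (hVtop : V < ⊤) (hV : ∀ x, g.vol (g.ball x ρ) ≤ V)
    (hcov : ∀ x, CoveredByBalls g.dist {y | g.dist x y < 2 * ρ} ρ K) {p : M} {a : ℝ}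
    (ha : HasCoveringGrowth g.dist p a) : g.upperVolumeEntropy p ≤ (a : EReal) := by
  obtain ⟨L, B, hL, hB, hgrow⟩ := ha
  -- Q bounds the number of ρ-balls needed to cover one L-ball.
  set Q := Real.exp (Real.log K / ρ * L) with hQ
  have hQ0 : 0 < Q := Real.exp_pos _
  -- The added 1 keeps the constant positive when V = 0.
  refine g.upperVolumeEntropy_le_of_vol_ball_le (B := B * Q * (V.toReal + 1))
    (by have := ENNReal.toReal_nonneg (a := V); positivity) fun R hR => ?_
  have h1 : CoveredByBalls g.dist {x | g.dist p x < R} ρ (B * Real.exp (a * R) * Q) :=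
    (hgrow R hR).refine hQ0.le
      (fun y _ => coveredByBalls_exp_of_doubling g.dist_triangle g.exists_dist_lt_and_lt hρ hK hcov
        y hL.le)
      fun x hx => ⟨x, hx, fun _ h => h⟩
  refine (g.vol_ball_le_of_coveredByBalls hV h1).trans ?_
  have h2 : V ≤ ENNReal.ofReal (V.toReal + 1) := by
    conv_lhs => rw [← ENNReal.ofReal_toReal hVtop.ne]
    exact ENNReal.ofReal_le_ofReal (by linarith)
  calc ENNReal.ofReal (B * Real.exp (a * R) * Q) * V
      ≤ ENNReal.ofReal (B * Real.exp (a * R) * Q) * ENNReal.ofReal (V.toReal + 1) := by gcongr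
    _ = ENNReal.ofReal (B * Q * (V.toReal + 1) * Real.exp (a * R)) := by
        rw [← ENNReal.ofReal_mul (by positivity)]
        ring_nf

end SmoothRiemannianMetric

theorem corollary1p6 {n : ℕ}
    {M : Type*} [TopologicalSpace M] [T2Space M] [SecondCountableTopology M] [ConnectedSpace M]
    [ChartedSpace (EuclideanSpace ℝ (Fin n)) M] [IsManifold (𝓡 n) ∞ M]
    [MeasurableSpace M] [BorelSpace M]
    {N : Type*} [TopologicalSpace N] [T2Space N] [CompactSpace N]
    [ChartedSpace (EuclideanSpace ℝ (Fin n)) N] [IsManifold (𝓡 n) ∞ N]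
    (g : SmoothRiemannianMetric n M) (h : SmoothRiemannianMetric n N)
    (f : M → N) (hf : IsRiemannianCovering g h f)
    (p : M) (hp : 0 < g.upperVolumeEntropy p)
    (c : ℝ) (hc : 0 < c) (hc1 : c ≠ 1) :
    ¬ AlmostIsometric g.dist (g.scale c hc).dist := by
  rintro ⟨C, φ, hφ⟩
  obtain ⟨ρ, K, V, hρ, hK, hVtop, hV, hcov⟩ := hf.exists_uniform_bounds
  have hscale : (g.scale c hc).dist = fun x y => √c * g.dist x y := by
    ext x y
    exact g.dist_scale c hc x y
  rw [hscale] at hφ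
  -- A real b is inserted because the entropy lives in `EReal`.
  obtain ⟨b, hb, hbp⟩ := EReal.lt_iff_exists_real_btwn.1 hp
  have hgrow : HasCoveringGrowth g.dist p (Real.log K / ρ) :=
    ⟨ρ, 1, hρ, one_pos, fun R hR => by
      simpa using coveredByBalls_exp_of_doubling g.dist_triangle g.exists_dist_lt_and_lt hρ hK
        hcov p hR⟩
  refine not_isAlmostIsometry_of_hasCoveringGrowth g.dist_comm g.dist_triangle g.dist_nonneg
    (Real.sqrt_pos.2 hc) (by simpa [Real.sqrt_eq_one] using hc1) hgrow
    (by exact_mod_cast hb) (fun a ha => ?_) hφ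
  have := hbp.le.trans
    (g.upperVolumeEntropy_le_of_hasCoveringGrowth hρ hK hVtop hV hcov ha)
  exact_mod_cast this
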